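/- Let $g:(0,\infty)^n\to\mathbb R$ be continuous and symmetric, and let $h:\mathbb R^n\to\mathbb R$, $h(x_1,\dots,x_n)=g(e^{x_1},\dots,e^{x_n})$. For $x\in\mathbb R^n$ let $x^{\downarrow}$ be the vector obtained by rearranging the components of $x$ in decreasing order, let $$D=\Big\{\big(x^{\downarrow}_1,\;x^{\downarrow}_1+x^{\downarrow}_2,\;\dots,\;\textstyle\sum_{i=1}^n x^{\downarrow}_i\big):x\in\mathbb R^n\Big\},$$ and let $p$ be the function on $D$ determined by $$p\big(x^{\downarrow}_1,\;x^{\downarrow}_1+x^{\downarrow}_2,\;\dots,\;\textstyle\sum_{i=1}^n x^{\downarrow}_i\big)=h(x_1,\dots,x_n)\qquad(x\in\mathbb R^n).$$ Suppose that (a) $h$ is convex, and (b) $p$ is nonincreasing in each argument (i.e. $p(y')\le p(y)$ whenever $y,y'\in D$ differ in one coordinate only and that coordinate is larger in $y'$). Let $GL(n,\mathbb R)^+$ be the group of real $n\times n$ matrices with positive determinant and define $$w:GL(n,\mathbb R)^+\to\mathbb R,\qquad w(F)=g(\sigma(F)),$$ where $\sigma(F)$ is the vector of singular values of $F$. Let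 $\Omega\subset\mathbb R^n$ be a bounded open set, and let $\varphi_k:\Omega\to\mathbb R^n$ $(k\in\mathbb N)$ be Lipschitz with a Lipschitz constant independent of $k$, such that $D\varphi_k(x)\in GL(n,\mathbb R)^+$ for almost every $x\in\Omega$ and every $k$, and such that $\varphi_k$ converges uniformly on $\Omega$ to a bi-Lipschitz map $u:\Omega\to\mathbb R^n$. Then $Du(x)\in GL(n,\mathbb R)^+$ for almost every $x\in\Omega$, the function $w(Du)$ is integrable on $\Omega$, each integral $\int_\Omega w(D\varphi_k)\,dx$ is well defined in $(-\infty,+\infty]$ (the integrand is measurable and its negative part is integrable), and $$\liminf_{k\to\infty}\int_\Omega w(D\varphi_k(x))\,dx\;\ge\;\int_\Omega w(Du(x))\,dx .$$ -/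

import Mathlib

open MeasureTheory Filter Topology
open scoped NNReal ENNReal

namespace GLLsc

/-- The rearrangement `x↓` of the components of `x` in decreasing order. -/
noncomputable def decreasingRearrangement {n : ℕ} (x : Fin n → ℝ) : Fin n → ℝ :=
  fun i => x (Tuple.sort x (Fin.rev i))

/-- The vector of partial sums `(x↓₁, x↓₁ + x↓₂, …, x↓₁ + ⋯ + x↓ₙ)`. -/
noncomputable def decreasingPartialSums {n : ℕ} (x : Fin n → ℝ) : Fin n → ℝ :=
  fun k => ∑ i ∈ Finset.Iic k, decreasingRearrangement x i

/-- `p` is associated to the function `h`: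
`p (x↓₁, x↓₁ + x↓₂, …, x↓₁ + ⋯ + x↓ₙ) = h (x₁, …, xₙ)` for all `x`.
For symmetric `h`, this determines `p` exactly on the set of all vectors of such partial sums. -/
def IsAssociated {n : ℕ} (p h : (Fin n → ℝ) → ℝ) : Prop :=
  ∀ x, p (decreasingPartialSums x) = h x

/-- On the set `D`, the function `p` is nonincreasing in each of its arguments separately. -/
def NonincreasingInEachArgumentOn {n : ℕ} (p : (Fin n → ℝ) → ℝ) (D : Set (Fin n → ℝ)) : Prop :=
  ∀ y ∈ D, ∀ (k : Fin n) (t : ℝ), y k ≤ t → Function.update y k t ∈ D →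
    p (Function.update y k t) ≤ p y

/-- `w(F) = g(σ(F))`, where `σ(F)` is the vector of the singular values of `F`. -/
noncomputable def isotropicPotential {n : ℕ} (g : (Fin n → ℝ) → ℝ)
    (F : EuclideanSpace ℝ (Fin n) →L[ℝ] EuclideanSpace ℝ (Fin n)) : ℝ :=
  g (fun i => F.toLinearMap.singularValues i)

/-- The group `GL(n, ℝ)⁺` of linear maps with positive determinant, as a set of linear maps. -/
def glPos (n : ℕ) : Set (EuclideanSpace ℝ (Fin n) →L[ℝ] EuclideanSpace ℝ (Fin n)) :=
  {F | 0 < F.det}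

/-- `u` is bi-Lipschitz on `Ω` (a bi-Lipschitz bijection of `Ω` onto its image). -/
def IsBiLipschitzOn {n : ℕ} (u : EuclideanSpace ℝ (Fin n) → EuclideanSpace ℝ (Fin n))
    (Ω : Set (EuclideanSpace ℝ (Fin n))) : Prop :=
  (∃ K : ℝ≥0, LipschitzOnWith K u Ω) ∧
    ∃ K : ℝ≥0, ∀ x ∈ Ω, ∀ y ∈ Ω, dist x y ≤ K * dist (u x) (u y)

/-- The extended-real integral `∫ f⁺ - ∫ f⁻`. It is the integral of `f` with values in
`(-∞, +∞]` when `f` is a.e. measurable and `∫ f⁻ < ∞`. -/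
noncomputable def extIntegral {α : Type*} [MeasurableSpace α] (μ : Measure α) (f : α → ℝ) :
    EReal :=
  ((∫⁻ x, ENNReal.ofReal (f x) ∂μ : ℝ≥0∞) : EReal) -
    ((∫⁻ x, ENNReal.ofReal (-f x) ∂μ : ℝ≥0∞) : EReal)

end GLLsc

namespace GLLsc

/-! Monotonicity of `p` and convexity together force `h` to be a nonincreasing function of the sum
of its arguments alone (`le_of_sum_le`). Near a strictly decreasing vector the partial sums vary
independently, so raising them slightly cannot increase `h`. Convexity makes this global: `h x ≤ h
c` for every `c`, ordered or not, whose partial sums in the given order are dominated by those of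
`x`. Arranging `c` increasingly turns domination into a condition on the total sums only.

The logarithms of the singular values add up to `log det F`, so `w(F) = G(det F)` with `G` convex
and nonincreasing on `(0,∞)` (`isotropicPotential_eq`, `convexOn_comp_log`). What remains is weak-*
convergence of the Jacobians of uniformly Lipschitz, uniformly convergent maps
(`tendsto_integral_mul_jac`). It follows by integration by parts from the vanishing of the integral
of the Jacobian of a compactly supported Lipschitz map, which a change of variables and polarization
provide.

The weak limit gives `det Du ≥ 0`, and the bi-Lipschitz bound keeps it away from `0`. Hence `G` has
a bounded measurable subgradient `q` along `det Du`, and integrating `G(det Dφₖ) ≥ G(det Du) + q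
(det Dφₖ - det Du)` yields the inequality. -/

/-! ### Ordered partial sums and the reduction of `h` to the total sum -/

lemma decreasingRearrangement_of_antitone {n : ℕ} {x : Fin n → ℝ} (hx : Antitone x) :
    decreasingRearrangement x = x := by
  have h1 := Tuple.monotone_sort x
  have h2 : Monotone (x ∘ (Fin.revPerm : Equiv.Perm (Fin n))) :=
    fun i j hij => hx (Fin.rev_le_rev.mpr hij)
  have h3 := Tuple.unique_monotone h1 h2
  ext i
  have := congrFun h3 (Fin.rev i)
  simpa [decreasingRearrangement] using this

lemma decreasingPartialSums_of_antitone {n : ℕ} {x : Fin n → ℝ} (hx : Antitone x) (k : Fin n) :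
    decreasingPartialSums x k = ∑ i ∈ Finset.Iic k, x i := by
  simp [decreasingPartialSums, decreasingRearrangement_of_antitone hx]

lemma eq_of_sum_Iic_eq {n : ℕ} {f g : Fin n → ℝ}
    (h : ∀ k, ∑ i ∈ Finset.Iic k, f i = ∑ i ∈ Finset.Iic k, g i) : f = g := by
  ext k
  induction k using WellFoundedLT.induction with
  | ind k ih =>
    have h1 := h k
    rw [← Finset.Iio_insert, Finset.sum_insert (by simp), Finset.sum_insert (by simp),
      Finset.sum_congr rfl (fun i hi => ih i (Finset.mem_Iio.mp hi))] at h1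
    linarith

/-- The vector `eⱼ - eⱼ₊₁` (and `eₙ₋₁` for the last index), whose partial sums are
the standard basis vector `eⱼ`. -/
def stepVector {n : ℕ} (j : Fin n) : Fin n → ℝ :=
  fun i => (if i = j then 1 else 0) - (if (i : ℕ) = j + 1 then 1 else 0)

lemma sum_Iic_stepVector {n : ℕ} (j k : Fin n) :
    ∑ i ∈ Finset.Iic k, stepVector j i = if k = j then 1 else 0 := by
  simp only [stepVector, Finset.sum_sub_distrib, Finset.sum_ite_eq', Finset.mem_Iic]
  by_cases hj : (j : ℕ) + 1 < n
  · have : ∀ i : Fin n, ((i : ℕ) = j + 1) ↔ i = ⟨j + 1, hj⟩ := fun i => by simp [Fin.ext_iff]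
    simp only [this, Finset.sum_ite_eq', Finset.mem_Iic]
    simp only [Fin.le_def, Fin.ext_iff]
    split_ifs <;> first | omega | norm_num
  · have : ∀ i : Fin n, ¬ ((i : ℕ) = j + 1) := fun i => by omega
    simp only [this, if_false, Finset.sum_const_zero, sub_zero]
    simp only [Fin.le_def, Fin.ext_iff]
    split_ifs <;> first | omega | norm_num

lemma sum_smul_stepVector {n : ℕ} (d : Fin n → ℝ) :
    ∑ j, (∑ i ∈ Finset.Iic j, d i) • stepVector j = d := by
  apply eq_of_sum_Iic_eq
  intro k
  simp only [Finset.sum_apply, Pi.smul_apply, smul_eq_mul]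
  rw [Finset.sum_comm]
  simp [← Finset.mul_sum, sum_Iic_stepVector]

/-- Small perturbations of a strictly decreasing vector stay ordered, so the partial sums can be
raised one coordinate at a time without leaving the domain of `p`. -/
lemma eventually_le_of_strictAnti {n : ℕ} {p h : (Fin n → ℝ) → ℝ} (hp : IsAssociated p h)
    (hmono : NonincreasingInEachArgumentOn p (Set.range decreasingPartialSums))
    {x d : Fin n → ℝ} (hx : StrictAnti x) (hd : ∀ k, 0 ≤ ∑ i ∈ Finset.Iic k, d i) :
    ∃ ε : ℝ, 0 < ε ∧ h (x + ε • d) ≤ h x := by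
  set a : Fin n → ℝ := fun j => ∑ i ∈ Finset.Iic j, d i with ha
  let z : ℝ → Finset (Fin n) → Fin n → ℝ := fun ε S => x + ε • ∑ j ∈ S, a j • stepVector j
  -- One `ε` must keep every intermediate point ordered; only finitely many strict inequalities are
  -- involved.
  have hev : ∀ᶠ ε in 𝓝[>] (0 : ℝ), ∀ S : Finset (Fin n), ∀ i j : Fin n, i < j →
      z ε S j < z ε S i := by
    apply Filter.Eventually.filter_mono nhdsWithin_le_nhds
    simp only [eventually_all]
    intro S i j hij
    have hc : ∀ l, Continuous fun ε => z ε S l := fun l => by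
      simp only [z, Pi.add_apply, Pi.smul_apply, smul_eq_mul]
      fun_prop
    refine (hc j).continuousAt.eventually_lt (hc i).continuousAt ?_
    simpa [z] using hx hij
  obtain ⟨ε, hε, hpos⟩ := (hev.and self_mem_nhdsWithin).exists
  have hpos : 0 < ε := hpos
  refine ⟨ε, hpos, ?_⟩
  have hanti : ∀ S, Antitone (z ε S) := fun S =>
    StrictAnti.antitone fun i j hij => hε S i j hij
  have key : ∀ S : Finset (Fin n), h (z ε S) ≤ h x := by
    intro S
    induction S using Finset.induction_on with
    | empty => simp [z]
    | insert j S hj ih =>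
      refine le_trans ?_ ih
      rw [← hp, ← hp]
      have hy : decreasingPartialSums (z ε (insert j S)) =
          Function.update (decreasingPartialSums (z ε S)) j
            (decreasingPartialSums (z ε S) j + ε * a j) := by
        have hstep : z ε (insert j S) = z ε S + (ε * a j) • stepVector j := by
          simp only [z, Finset.sum_insert hj, smul_add, smul_smul]
          abel
        have hsum : ∀ k, decreasingPartialSums (z ε (insert j S)) k =
            decreasingPartialSums (z ε S) k + ε * a j * (if k = j then 1 else 0) := by
          intro k
          rw [decreasingPartialSums_of_antitone (hanti _),
            decreasingPartialSums_of_antitone (hanti _), hstep, ← sum_Iic_stepVector]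
          simp [Finset.sum_add_distrib, Finset.mul_sum]
        ext k
        by_cases hk : k = j
        · subst hk; simp [hsum]
        · simp [hsum, hk]
      rw [hy]
      refine hmono _ ⟨_, rfl⟩ j _ ?_ ⟨_, hy⟩
      have := mul_nonneg hpos.le (hd j)
      linarith
  have := key Finset.univ
  rwa [show z ε Finset.univ = x + ε • d by simp only [z, ha, sum_smul_stepVector]] at this

/-- The point `x` lies on the segment from `c` to `x + ε (x - c)`, where `h` is at most `h x` at the
far end; convexity then bounds `h x` by `h c`. No ordering of `c` is needed. -/
lemma le_of_strictAnti {n : ℕ} {p h : (Fin n → ℝ) → ℝ} (hp : IsAssociated p h)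
    (hmono : NonincreasingInEachArgumentOn p (Set.range decreasingPartialSums))
    (hconv : ConvexOn ℝ Set.univ h)
    {x c : Fin n → ℝ} (hx : StrictAnti x) (hd : ∀ k, 0 ≤ ∑ i ∈ Finset.Iic k, (x - c) i) :
    h x ≤ h c := by
  obtain ⟨ε, hε, hle⟩ := eventually_le_of_strictAnti hp hmono hx hd
  have h1 : (0 : ℝ) < 1 + ε := by positivity
  have := hconv.2 (Set.mem_univ c) (Set.mem_univ (x + ε • (x - c)))
    (show 0 ≤ ε / (1 + ε) by positivity) (show 0 ≤ 1 / (1 + ε) by positivity)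
    (by field_simp; ring)
  have hcomb : (ε / (1 + ε)) • c + (1 / (1 + ε)) • (x + ε • (x - c)) = x := by
    ext i
    simp only [Pi.add_apply, Pi.smul_apply, Pi.sub_apply, smul_eq_mul]
    field_simp
    ring
  rw [hcomb, smul_eq_mul, smul_eq_mul] at this
  have h2 : h x ≤ ε / (1 + ε) * h c + 1 / (1 + ε) * h x := by
    refine this.trans ?_
    gcongr
  field_simp at h2
  nlinarith

/-- A negative partial sum forces its last term, hence all later terms, to be nonpositive, which
makes the total negative. -/
lemma sum_Iic_nonneg_of_antitone {n : ℕ} {d : Fin n → ℝ} (hd : Antitone d) (h0 : 0 ≤ ∑ i, d i)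
    (k : Fin n) : 0 ≤ ∑ i ∈ Finset.Iic k, d i := by
  by_contra! hneg
  have hk : d k < 0 := by
    by_contra! hk
    exact absurd (Finset.sum_nonneg fun i hi => hk.trans (hd (Finset.mem_Iic.mp hi))) hneg.not_ge
  have h2 : ∑ i ∈ (Finset.Iic k)ᶜ, d i ≤ 0 := by
    refine Finset.sum_nonpos fun i hi => (hd ?_).trans hk.le
    simp only [Finset.mem_compl, Finset.mem_Iic, not_le] at hi
    exact hi.le
  have := Finset.sum_add_sum_compl (Finset.Iic k) d
  linarith

/-- A convex symmetric function whose associated function of the ordered partial sums is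
nonincreasing in each argument is a nonincreasing function of the sum of the components. -/
theorem le_of_sum_le {n : ℕ} {p h : (Fin n → ℝ) → ℝ} (hp : IsAssociated p h)
    (hmono : NonincreasingInEachArgumentOn p (Set.range decreasingPartialSums))
    (hconv : ConvexOn ℝ Set.univ h) (hcont : Continuous h)
    (hsymm : ∀ (x : Fin n → ℝ) (π : Equiv.Perm (Fin n)), h (x ∘ π) = h x)
    {x c : Fin n → ℝ} (hxc : ∑ i, c i ≤ ∑ i, x i) : h x ≤ h c := by
  -- Opposite orders for `c` and `x` make `x' - c'` decreasing, so a nonnegative total suffices for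
  -- all partial sums.
  set c' := c ∘ Tuple.sort c with hc'
  have hc'm : Monotone c' := Tuple.monotone_sort c
  set τ : Equiv.Perm (Fin n) := Fin.revPerm.trans (Tuple.sort x) with hτ
  set x' := x ∘ τ with hx'
  have hx'm : Antitone x' := fun i j hij => Tuple.monotone_sort x (Fin.rev_le_rev.mpr hij)
  rw [← hsymm x τ, ← hsymm c (Tuple.sort c), ← hx', ← hc']
  have hsum : ∑ i, c' i ≤ ∑ i, x' i := by
    rwa [hc', hx', show ∑ i, (c ∘ Tuple.sort c) i = ∑ i, c i from Equiv.sum_comp _ c,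
      show ∑ i, (x ∘ τ) i = ∑ i, x i from Equiv.sum_comp _ x]
  -- Adding `δ ρ` makes the ordering strict without lowering the sum; continuity removes it as `δ →
  -- 0`.
  let ρ : Fin n → ℝ := fun i => (n : ℝ) - i
  have hρ : ∀ i, 0 ≤ ρ i := fun i => by
    have : ((i : ℕ) : ℝ) ≤ n := by exact_mod_cast i.2.le
    simp only [ρ]; linarith
  have hρa : StrictAnti ρ := fun i j hij => by
    have : ((i : ℕ) : ℝ) < (j : ℕ) := by exact_mod_cast hij
    simp only [ρ]; linarith
  have hlim : Tendsto (fun δ : ℝ => h (x' + δ • ρ)) (𝓝[>] 0) (𝓝 (h x')) := by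
    have : Continuous fun δ : ℝ => h (x' + δ • ρ) := by fun_prop
    have h2 := this.tendsto 0
    simp only [zero_smul, add_zero] at h2
    exact h2.mono_left nhdsWithin_le_nhds
  refine le_of_tendsto hlim ?_
  filter_upwards [self_mem_nhdsWithin] with δ hδ
  have hδ : 0 < δ := hδ
  have hs : StrictAnti (x' + δ • ρ) := fun i j hij => by
    have h1 := hx'm hij.le
    have h2 := mul_lt_mul_of_pos_left (hρa hij) hδ
    simp only [Pi.add_apply, Pi.smul_apply, smul_eq_mul]
    linarith
  refine le_of_strictAnti hp hmono hconv hs (sum_Iic_nonneg_of_antitone ?_ ?_)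
  · intro i j hij
    have h1 := hs.antitone hij
    have h2 := hc'm hij
    simp only [Pi.sub_apply]
    linarith
  · have h3 : 0 ≤ ∑ i, δ * ρ i := Finset.sum_nonneg fun i _ => mul_nonneg hδ.le (hρ i)
    simp only [Pi.sub_apply, Pi.add_apply, Pi.smul_apply, smul_eq_mul, Finset.sum_sub_distrib,
      Finset.sum_add_distrib]
    linarith

/-! ### The potential as a convex function of the determinant -/

/-- For `h` depending only on the sum of the components, the profile `t ↦ h (t/n, …, t/n)`. -/
noncomputable def sumProfile {n : ℕ} (h : (Fin n → ℝ) → ℝ) (s : ℝ) : ℝ := h fun _ => s / n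

lemma eq_sumProfile {n : ℕ} {h : (Fin n → ℝ) → ℝ}
    (hle : ∀ {x c : Fin n → ℝ}, ∑ i, c i ≤ ∑ i, x i → h x ≤ h c) (x : Fin n → ℝ) :
    h x = sumProfile h (∑ i, x i) := by
  have : ∑ _i : Fin n, (∑ i, x i) / (n : ℝ) = ∑ i, x i := by
    rcases Nat.eq_zero_or_pos n with rfl | hn
    · simp
    · simp only [Finset.sum_const, Finset.card_univ, Fintype.card_fin, nsmul_eq_mul]
      field_simp
  exact le_antisymm (hle this.le) (hle this.ge)

lemma antitone_sumProfile {n : ℕ} {h : (Fin n → ℝ) → ℝ}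
    (hle : ∀ {x c : Fin n → ℝ}, ∑ i, c i ≤ ∑ i, x i → h x ≤ h c) : Antitone (sumProfile h) := by
  intro s t hst
  refine hle (Finset.sum_le_sum fun i _ => ?_)
  gcongr

lemma convexOn_sumProfile {n : ℕ} {h : (Fin n → ℝ) → ℝ} (hconv : ConvexOn ℝ Set.univ h) :
    ConvexOn ℝ Set.univ (sumProfile h) := by
  refine ⟨convex_univ, fun s _ t _ a b ha hb hab => ?_⟩
  refine le_trans (le_of_eq ?_) (hconv.2 (Set.mem_univ _) (Set.mem_univ _) ha hb hab)
  simp only [sumProfile]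
  congr 1
  ext i
  simp only [Pi.add_apply, Pi.smul_apply, smul_eq_mul]
  ring

lemma convexOn_comp_log {f : ℝ → ℝ} (hf : ConvexOn ℝ Set.univ f) (hanti : Antitone f) :
    ConvexOn ℝ (Set.Ioi 0) (fun t => f (Real.log t)) := by
  have himg : Real.log '' Set.Ioi 0 = Set.univ := by
    refine Set.eq_univ_of_forall fun y => ⟨Real.exp y, Real.exp_pos y, Real.log_exp y⟩
  refine ConvexOn.comp_concaveOn (f := Real.log) (g := f) ?_ strictConcaveOn_log_Ioi.concaveOn
    (hanti.antitoneOn _)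
  rwa [himg]

lemma prod_singularValues_eq_abs_det {n : ℕ}
    (F : EuclideanSpace ℝ (Fin n) →L[ℝ] EuclideanSpace ℝ (Fin n)) :
    ∏ i : Fin n, F.toLinearMap.singularValues i = |F.det| := by
  have := LinearMap.normDet_eq_prod_singularValues F.toLinearMap
  rw [LinearMap.normDet_eq_abs_det, finrank_euclideanSpace, Fintype.card_fin,
    ← Fin.prod_univ_eq_prod_range (fun i => F.toLinearMap.singularValues i)] at this
  exact this.symm

lemma isotropicPotential_eq {n : ℕ} {g h : (Fin n → ℝ) → ℝ}
    (hh : ∀ x, h x = g (fun i => Real.exp (x i)))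
    (hle : ∀ {x c : Fin n → ℝ}, ∑ i, c i ≤ ∑ i, x i → h x ≤ h c)
    {F : EuclideanSpace ℝ (Fin n) →L[ℝ] EuclideanSpace ℝ (Fin n)} (hF : F ∈ glPos n) :
    isotropicPotential g F = sumProfile h (Real.log F.det) := by
  have hF : 0 < F.det := hF
  have hprod := prod_singularValues_eq_abs_det F
  rw [abs_of_pos hF] at hprod
  have hne : ∀ i ∈ Finset.univ, F.toLinearMap.singularValues (i : Fin n) ≠ 0 := by
    rw [← Finset.prod_ne_zero_iff, hprod]
    exact hF.ne'
  have hlog : Real.log F.det = ∑ i : Fin n, Real.log (F.toLinearMap.singularValues i) := by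
    rw [← hprod, Real.log_prod hne]
  rw [hlog, ← eq_sumProfile hle, hh, isotropicPotential]
  congr 1
  ext i
  exact (Real.exp_log (lt_of_le_of_ne (LinearMap.singularValues_nonneg _ _)
    (hne i (Finset.mem_univ i)).symm)).symm

/-! ### Jacobian determinants of Lipschitz maps -/

/-- The vector of partial derivatives. -/
noncomputable def partials {n : ℕ} (f : EuclideanSpace ℝ (Fin n) → ℝ)
    (x : EuclideanSpace ℝ (Fin n)) : Fin n → ℝ :=
  fun j => fderiv ℝ f x (EuclideanSpace.single j 1)

/-- The Jacobian determinant of a family of `n` scalar functions on `ℝⁿ`. -/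
noncomputable def jac {n : ℕ} (f : Fin n → EuclideanSpace ℝ (Fin n) → ℝ)
    (x : EuclideanSpace ℝ (Fin n)) : ℝ :=
  (Matrix.detRowAlternating (R := ℝ) (n := Fin n)).toMultilinearMap fun i => partials (f i) x

variable {n : ℕ}

lemma measurable_jac (f : Fin n → EuclideanSpace ℝ (Fin n) → ℝ) : Measurable (jac f) := by
  have : jac f = fun x => ∑ σ : Equiv.Perm (Fin n), ((Equiv.Perm.sign σ : ℤ) : ℝ) *
      ∏ i, partials (f (σ i)) x i := by
    ext x
    exact Matrix.det_apply' _
  rw [this]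
  refine Finset.measurable_sum _ fun σ _ => Measurable.const_mul ?_ _
  exact Finset.measurable_prod _ fun i _ => measurable_fderiv_apply_const ℝ _ _

lemma abs_partials_le {f : EuclideanSpace ℝ (Fin n) → ℝ} {K : ℝ≥0} (hf : LipschitzWith K f)
    (x : EuclideanSpace ℝ (Fin n)) (j : Fin n) : |partials f x j| ≤ K := by
  have h1 := (fderiv ℝ f x).le_opNorm (EuclideanSpace.single j 1)
  simp only [PiLp.norm_single, norm_one, mul_one] at h1
  exact h1.trans (norm_fderiv_le_of_lipschitz ℝ hf)

lemma abs_jac_le {f : Fin n → EuclideanSpace ℝ (Fin n) → ℝ} {K : ℝ≥0}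
    (hf : ∀ i, LipschitzWith K (f i)) (x : EuclideanSpace ℝ (Fin n)) :
    |jac f x| ≤ n.factorial * (K : ℝ) ^ n := by
  have := Matrix.det_le (A := fun i => partials (f i) x) (abv := AbsoluteValue.abs) (x := (K : ℝ))
    (fun i j => abs_partials_le (hf i) x j)
  simp only [Fintype.card_fin, nsmul_eq_mul] at this
  exact this

lemma jac_congr_of_eventuallyEq {f g : Fin n → EuclideanSpace ℝ (Fin n) → ℝ}
    {x : EuclideanSpace ℝ (Fin n)} (h : ∀ i, f i =ᶠ[𝓝 x] g i) : jac f x = jac g x := by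
  unfold jac partials
  simp only [fun i => (h i).fderiv_eq (𝕜 := ℝ)]

lemma partials_eq_zero_of_eventuallyEq {f : EuclideanSpace ℝ (Fin n) → ℝ}
    {x : EuclideanSpace ℝ (Fin n)} (h : f =ᶠ[𝓝 x] fun _ => 0) : partials f x = 0 := by
  ext j
  simp [partials, h.fderiv_eq]

lemma jac_eq_zero_of_eventuallyEq {f : Fin n → EuclideanSpace ℝ (Fin n) → ℝ}
    {x : EuclideanSpace ℝ (Fin n)} (i : Fin n) (h : f i =ᶠ[𝓝 x] fun _ => 0) : jac f x = 0 :=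
  MultilinearMap.map_coord_zero _ i (partials_eq_zero_of_eventuallyEq h)

lemma jac_eq_zero_of_notMem_tsupport {f : Fin n → EuclideanSpace ℝ (Fin n) → ℝ}
    {x : EuclideanSpace ℝ (Fin n)} (i : Fin n) (h : x ∉ tsupport (f i)) : jac f x = 0 :=
  jac_eq_zero_of_eventuallyEq i (notMem_tsupport_iff_eventuallyEq.mp h)

lemma partials_update (f : Fin n → EuclideanSpace ℝ (Fin n) → ℝ) (i : Fin n)
    (w : EuclideanSpace ℝ (Fin n) → ℝ) (x : EuclideanSpace ℝ (Fin n)) :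
    (fun j => partials (Function.update f i w j) x) =
      Function.update (fun j => partials (f j) x) i (partials w x) := by
  ext j : 1
  by_cases hj : j = i
  · subst hj; simp
  · simp [hj]

lemma det_fderiv_eq_jac {F : EuclideanSpace ℝ (Fin n) → EuclideanSpace ℝ (Fin n)}
    {x : EuclideanSpace ℝ (Fin n)} (hF : DifferentiableAt ℝ F x) :
    (fderiv ℝ F x).det = jac (fun i y => F y i) x := by
  have h1 := LinearMap.det_toMatrix (EuclideanSpace.basisFun (Fin n) ℝ).toBasis
    (fderiv ℝ F x).toLinearMap
  rw [ContinuousLinearMap.det, ← h1]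
  change _ = Matrix.det _
  congr 1
  ext i j
  rw [LinearMap.toMatrix_apply]
  have h2 : HasFDerivAt (fun y => F y i) ((EuclideanSpace.proj i).comp (fderiv ℝ F x)) x :=
    (EuclideanSpace.proj (𝕜 := ℝ) i).hasFDerivAt.comp x hF.hasFDerivAt
  simp [partials, h2.fderiv]

lemma volume_image_eq_zero_of_lipschitzWith
    {T : EuclideanSpace ℝ (Fin n) → EuclideanSpace ℝ (Fin n)} {K : ℝ≥0} (hT : LipschitzWith K T)
    {s : Set (EuclideanSpace ℝ (Fin n))} (hs : volume s = 0) : volume (T '' s) = 0 := by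
  let E := EuclideanSpace ℝ (Fin n)
  have h1 : (volume : Measure E) ≪ Measure.hausdorffMeasure (Module.finrank ℝ E) :=
    Measure.absolutelyContinuous_isAddHaarMeasure _ _
  have h2 : (Measure.hausdorffMeasure (Module.finrank ℝ E) : Measure E) ≪ volume :=
    Measure.absolutelyContinuous_isAddHaarMeasure _ _
  have h3 := hT.hausdorffMeasure_image_le (d := (Module.finrank ℝ E : ℝ)) (Nat.cast_nonneg _) s
  rw [h2 hs, mul_zero] at h3
  exact h1 (le_antisymm h3 zero_le)

/-- A Lipschitz perturbation of the identity with small constant, supported in a ball,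
maps that ball onto itself and so preserves its volume. -/
lemma exists_forall_setIntegral_jac_add_eq (n : ℕ) : ∃ ε : ℝ≥0, 0 < ε ∧
    ∀ (R : ℝ) (f : Fin n → EuclideanSpace ℝ (Fin n) → ℝ), (∀ i, LipschitzWith ε (f i)) →
      (∀ i, ∀ x ∉ Metric.closedBall (0 : EuclideanSpace ℝ (Fin n)) R, f i x = 0) →
      ∫ x in Metric.closedBall (0 : EuclideanSpace ℝ (Fin n)) R,
        jac (fun i y => y i + f i y) x =
        volume.real (Metric.closedBall (0 : EuclideanSpace ℝ (Fin n)) R) := by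
  set E := EuclideanSpace ℝ (Fin n) with hE
  set C : ℝ≥0 := (Fintype.card (Fin n) : ℝ≥0) ^ (1 / (2 : ℝ≥0∞)).toReal with hC
  have hCl : LipschitzWith C (WithLp.toLp 2 : (Fin n → ℝ) → E) :=
    PiLp.lipschitzWith_toLp 2 (fun _ : Fin n => ℝ)
  have hdet : ∀ᶠ A in 𝓝 (0 : E →L[ℝ] E), 0 < (ContinuousLinearMap.id ℝ E + A).det := by
    have hc : Continuous fun A : E →L[ℝ] E => (ContinuousLinearMap.id ℝ E + A).det :=
      ContinuousLinearMap.continuous_det.comp (by fun_prop)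
    exact (hc.tendsto 0).eventually_const_lt (by simp [ContinuousLinearMap.det])
  obtain ⟨δ, hδ, hδdet⟩ := Metric.eventually_nhds_iff_ball.mp hdet
  set m : ℝ≥0 := min δ.toNNReal 1 with hm
  have hmpos : 0 < m := lt_min (by simpa using hδ) one_pos
  -- `C` compares the sup and Euclidean norms. The choice gives `C * ε < m`: below `1` the map `T`
  -- is bijective, below `δ` its Jacobian is positive.
  refine ⟨m / (2 * (C + 1)), by positivity, fun R f hf hsupp => ?_⟩
  set ε : ℝ≥0 := m / (2 * (C + 1)) with hε
  let F : E → E := fun x => WithLp.toLp 2 fun i => f i x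
  have hCε : C * ε < m := by
    rw [hε, ← mul_div_assoc, div_lt_iff₀ (by positivity)]
    have : C < 2 * (C + 1) := by
      rw [← NNReal.coe_lt_coe]; push_cast; have := C.2; linarith [NNReal.coe_nonneg C]
    calc C * m < 2 * (C + 1) * m := by gcongr
      _ = m * (2 * (C + 1)) := mul_comm _ _
  have hF : LipschitzWith (C * ε) F := by
    refine hCl.comp (LipschitzWith.of_dist_le_mul fun x y => ?_)
    exact (dist_pi_le_iff (by positivity)).mpr fun i => (hf i).dist_le_mul x y
  have hFsupp : ∀ x ∉ Metric.closedBall (0 : E) R, F x = 0 := fun x hx => by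
    ext i; exact hsupp i x hx
  let T : E → E := fun x => x + F x
  have hT : LipschitzWith (1 + C * ε) T := LipschitzWith.id.add hF
  have hC1 : C * ε < 1 := hCε.trans_le (min_le_right _ _)
  have hinj : Function.Injective T := by
    intro x y hxy
    have h1 : dist x y ≤ (C * ε : ℝ≥0) * dist x y := by
      calc dist x y = dist (F x) (F y) := by
            rw [dist_eq_norm, dist_eq_norm, ← norm_neg (F x - F y)]
            congr 1
            have : x + F x = y + F y := hxy
            rw [neg_sub, sub_eq_sub_iff_add_eq_add, this, add_comm]
        _ ≤ _ := hF.dist_le_mul x y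
    have h2 : ((C * ε : ℝ≥0) : ℝ) < 1 := by exact_mod_cast hC1
    by_contra hne
    have h3 := dist_pos.mpr hne
    nlinarith
  have hsurj : Function.Surjective T := by
    rcases subsingleton_or_nontrivial E with hs | hs
    · exact fun y => ⟨y, Subsingleton.elim _ _⟩
    have ha : ApproximatesLinearOn T ((ContinuousLinearEquiv.refl ℝ E : E ≃L[ℝ] E) : E →L[ℝ] E)
        Set.univ (C * ε) := by
      rw [ApproximatesLinearOn.approximatesLinearOn_iff_lipschitzOnWith]
      refine LipschitzWith.lipschitzOnWith ?_
      have : T - ((ContinuousLinearEquiv.refl ℝ E : E →L[ℝ] E) : E → E) = F := by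
        ext x : 1
        exact add_sub_cancel_left x (F x)
      exact this ▸ hF
    refine ha.surjective (Or.inr ?_)
    have : ‖((ContinuousLinearEquiv.refl ℝ E).symm : E →L[ℝ] E)‖₊ = 1 := by
      rw [← NNReal.coe_inj]
      exact ContinuousLinearMap.norm_id
    rwa [this, inv_one]
  set B := Metric.closedBall (0 : E) R with hB
  have hTout : ∀ x ∉ B, T x = x := fun x hx => by simp [T, hFsupp x hx]
  -- A bijection that is the identity off `B` must map `B` onto `B`.
  have himg : T '' B = B := by
    apply Set.Subset.antisymm
    · rintro _ ⟨x, hx, rfl⟩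
      by_contra hTx
      exact hTx ((hinj (hTout _ hTx)).symm ▸ hx)
    · intro y hy
      obtain ⟨x, rfl⟩ := hsurj y
      by_contra hx
      have hxB : x ∉ B := fun h => hx ⟨x, h, rfl⟩
      exact hxB (hTout x hxB ▸ hy)
  set D := {x : E | DifferentiableAt ℝ F x} with hD
  have hDae : ∀ᵐ x : E, x ∈ D := hF.ae_differentiableAt
  have hs : (B ∩ D : Set E) =ᵐ[volume] B := by
    filter_upwards [hDae] with x hx
    exact propext ⟨fun h => h.1, fun h => ⟨h, hx⟩⟩
  have hTs : (T '' (B ∩ D) : Set E) =ᵐ[volume] B := by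
    have h0 : volume (B \ (B ∩ D)) = 0 := (ae_eq_set.mp hs).2
    have h1 := volume_image_eq_zero_of_lipschitzWith hT h0
    refine ae_eq_set.mpr ⟨?_, measure_mono_null ?_ h1⟩
    · rw [Set.sdiff_eq_empty.mpr ((Set.image_mono Set.inter_subset_left).trans himg.le)]
      exact measure_empty
    · rintro y ⟨hy, hy2⟩
      rw [← himg] at hy
      obtain ⟨x, hx, rfl⟩ := hy
      exact ⟨x, ⟨hx, fun h => hy2 ⟨x, h, rfl⟩⟩, rfl⟩
  have hTd : ∀ x ∈ D, HasFDerivAt T (ContinuousLinearMap.id ℝ E + fderiv ℝ F x) x := fun x hx =>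
    (hasFDerivAt_id x).add hx.hasFDerivAt
  have hmeas : MeasurableSet (B ∩ D) :=
    Metric.isClosed_closedBall.measurableSet.inter (measurableSet_of_differentiableAt ℝ F)
  have hchange := integral_image_eq_integral_abs_det_fderiv_smul volume hmeas
    (fun x hx => (hTd x hx.2).hasFDerivWithinAt) hinj.injOn (fun _ => (1 : ℝ))
  rw [setIntegral_congr_set hTs] at hchange
  simp only [smul_eq_mul, mul_one, integral_const, MeasurableSet.univ, measureReal_restrict_apply,
    Set.univ_inter] at hchange
  rw [hchange, ← setIntegral_congr_set hs]
  refine setIntegral_congr_fun hmeas fun x hx => ?_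
  have hpos : 0 < (ContinuousLinearMap.id ℝ E + fderiv ℝ F x).det := by
    refine hδdet _ ?_
    rw [mem_ball_zero_iff]
    have h1 := norm_fderiv_le_of_lipschitz ℝ hF (x₀ := x)
    have h2 : ((C * ε : ℝ≥0) : ℝ) < m := by exact_mod_cast hCε
    have h3 : (m : ℝ) ≤ δ := by
      have : (m : ℝ) ≤ (δ.toNNReal : ℝ) := by exact_mod_cast min_le_left _ _
      rwa [Real.coe_toNNReal _ hδ.le] at this
    linarith
  simp only
  rw [abs_of_pos hpos, ← (hTd x hx.2).fderiv, det_fderiv_eq_jac (hTd x hx.2).differentiableAt]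
  rfl

lemma partials_add_const_smul {f g : EuclideanSpace ℝ (Fin n) → ℝ} {x : EuclideanSpace ℝ (Fin n)}
    (hf : DifferentiableAt ℝ f x) (hg : DifferentiableAt ℝ g x) (c : ℝ) :
    partials (fun y => f y + c * g y) x = partials f x + c • partials g x := by
  ext j
  have : HasFDerivAt (fun y => f y + c * g y) (fderiv ℝ f x + c • fderiv ℝ g x) x :=
    hf.hasFDerivAt.add (hg.hasFDerivAt.const_mul c)
  simp [partials, this.fderiv]

lemma partials_mul {f g : EuclideanSpace ℝ (Fin n) → ℝ} {x : EuclideanSpace ℝ (Fin n)}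
    (hf : DifferentiableAt ℝ f x) (hg : DifferentiableAt ℝ g x) :
    partials (fun y => f y * g y) x = f x • partials g x + g x • partials f x := by
  ext j
  simp [partials, fderiv_fun_mul hf hg]

lemma integrableOn_jac {f : Fin n → EuclideanSpace ℝ (Fin n) → ℝ}
    {K : ℝ≥0} (hf : ∀ i, LipschitzWith K (f i)) {s : Set (EuclideanSpace ℝ (Fin n))}
    (hs : volume s ≠ ⊤) : IntegrableOn (jac f) s volume :=
  Measure.integrableOn_of_bounded hs (measurable_jac f).aestronglyMeasurable
    (ae_of_all _ fun x => abs_jac_le hf x)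

lemma sum_prod_piecewise_one_neg_one (hn : 0 < n) :
    ∑ S : Finset (Fin n), ∏ i, (S.piecewise (1 : Fin n → ℝ) (-1)) i = 0 := by
  have := (MultilinearMap.mkPiAlgebra ℝ (Fin n) ℝ).map_add_univ 1 (-1)
  simp only [MultilinearMap.mkPiAlgebra_apply] at this
  rw [← this]
  simp [hn.ne']

/-- Expand `v = (e + v) - e` in every slot. With `e` the rows of the identity, each term becomes the
Jacobian of a perturbed identity. -/
lemma map_eq_sum_piecewise {V : Type*} [AddCommGroup V] [Module ℝ V]
    (D : MultilinearMap ℝ (fun _ : Fin n => V) ℝ) (e v : Fin n → V) :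
    D v = ∑ S : Finset (Fin n), (∏ i, (S.piecewise (1 : Fin n → ℝ) (-1)) i) *
      D (S.piecewise (e + v) e) := by
  have h1 := D.map_add_univ (e + v) (-e)
  rw [show e + v + -e = v by abel] at h1
  rw [h1]
  refine Finset.sum_congr rfl fun S _ => ?_
  rw [← smul_eq_mul, ← D.map_smul_univ]
  congr 1
  ext i
  by_cases hi : i ∈ S <;> simp [hi]

/-- The Jacobian determinant of a compactly supported Lipschitz map has zero integral. -/
theorem integral_jac_eq_zero_of_forall_hasCompactSupport (hn : 0 < n)
    {f : Fin n → EuclideanSpace ℝ (Fin n) → ℝ} {K : ℝ≥0} (hf : ∀ i, LipschitzWith K (f i))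
    (hc : ∀ i, HasCompactSupport (f i)) : ∫ x, jac f x = 0 := by
  obtain ⟨ε, hε, hvol⟩ := exists_forall_setIntegral_jac_add_eq n
  -- Scaling by `s` makes the perturbation small enough for the volume identity; multilinearity only
  -- costs the factor `s ^ n`.
  set s : ℝ≥0 := ε / (K + 1) with hs
  have hspos : 0 < s := by positivity
  have hsK : s * K ≤ ε := by
    rw [hs, div_mul_eq_mul_div, div_le_iff₀ (by positivity)]
    gcongr
    exact le_self_add
  have hbdd : Bornology.IsBounded (⋃ i, tsupport (f i)) :=
    (isCompact_iUnion fun i => (hc i).isCompact).isBounded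
  obtain ⟨R, hR⟩ := hbdd.subset_closedBall 0
  set B := Metric.closedBall (0 : EuclideanSpace ℝ (Fin n)) R with hB
  have hout : ∀ i, ∀ x ∉ B, x ∉ tsupport (f i) := fun i x hx h =>
    hx (hR (Set.mem_iUnion.mpr ⟨i, h⟩))
  let e : Fin n → EuclideanSpace ℝ (Fin n) → ℝ := fun i y => y i
  let F : Finset (Fin n) → Fin n → EuclideanSpace ℝ (Fin n) → ℝ := fun S i y =>
    e i y + (if i ∈ S then (s : ℝ) else 0) * f i y
  have hlip_f : ∀ (S : Finset (Fin n)) i,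
      LipschitzWith (s * K) fun y => (if i ∈ S then (s : ℝ) else 0) * f i y := by
    intro S i
    refine LipschitzWith.of_dist_le_mul fun x y => ?_
    by_cases hi : i ∈ S
    · simp only [hi, if_true, Real.dist_eq, ← mul_sub, abs_mul]
      rw [NNReal.abs_eq, ← Real.dist_eq, NNReal.coe_mul, mul_assoc]
      gcongr
      exact (hf i).dist_le_mul x y
    · simp only [hi, if_false, zero_mul, dist_self]
      positivity
  have hFint : ∀ S, ∫ x in B, jac (F S) x = volume.real B := fun S =>
    hvol R (fun i y => (if i ∈ S then (s : ℝ) else 0) * f i y) (fun i => (hlip_f S i).weaken hsK)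
      fun i x hx => by simp [image_eq_zero_of_notMem_tsupport (hout i x hx)]
  have hlip_e : ∀ i, LipschitzWith 1 (e i) := fun i =>
    LipschitzWith.of_dist_le_mul fun x y => by
      simpa [dist_eq_norm] using PiLp.norm_apply_le (x - y) i
  have hlip : ∀ S i, LipschitzWith (1 + s * K) (F S i) := fun S i =>
    (hlip_e i).add (hlip_f S i)
  have hpoint : ∀ᵐ x, (s : ℝ) ^ n * jac f x = ∑ S : Finset (Fin n),
      (∏ i, (S.piecewise (1 : Fin n → ℝ) (-1)) i) * jac (F S) x := by
    have hd : ∀ᵐ x, ∀ i, DifferentiableAt ℝ (f i) x :=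
      ae_all_iff.mpr fun i => (hf i).ae_differentiableAt
    filter_upwards [hd] with x hx
    have he : ∀ i, DifferentiableAt ℝ (e i) x := fun i =>
      (EuclideanSpace.proj (𝕜 := ℝ) i).differentiableAt
    have h1 := map_eq_sum_piecewise
      (Matrix.detRowAlternating (R := ℝ) (n := Fin n)).toMultilinearMap
      (fun i => partials (e i) x) (fun i => (s : ℝ) • partials (f i) x)
    have h2 := (Matrix.detRowAlternating (R := ℝ) (n := Fin n)).toMultilinearMap.map_smul_univ
      (fun _ => (s : ℝ)) (fun i => partials (f i) x)
    rw [h2, Finset.prod_const, Finset.card_univ, Fintype.card_fin, smul_eq_mul] at h1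
    refine h1.trans (Finset.sum_congr rfl fun S _ => ?_)
    congr 2
    ext i : 1
    simp only [F]
    rw [partials_add_const_smul (he i) (hx i)]
    by_cases hi : i ∈ S <;> simp [hi]
  have hBfin : volume B ≠ ⊤ := measure_closedBall_lt_top.ne
  have hmain : (s : ℝ) ^ n * ∫ x in B, jac f x = 0 := by
    rw [← integral_const_mul, integral_congr_ae (ae_restrict_of_ae hpoint),
      integral_finsetSum _ fun S _ => (integrableOn_jac (hlip S) hBfin).const_mul _]
    -- All terms have the same integral, and the signs cancel because `n > 0`.
    simp_rw [integral_const_mul, hFint]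
    rw [← Finset.sum_mul, sum_prod_piecewise_one_neg_one hn, zero_mul]
  have hz := (mul_eq_zero.mp hmain).resolve_left (by positivity)
  rwa [setIntegral_eq_integral_of_forall_compl_eq_zero fun x hx =>
    jac_eq_zero_of_notMem_tsupport ⟨0, hn⟩ (hout _ x hx)] at hz

/-! ### Integration by parts and weak continuity of Jacobians -/

/-- Although `g` may be unbounded, the product rule for differences evaluates it only at one
endpoint, which can be taken in the support of `f`. -/
lemma exists_lipschitzWith_mul {f g : EuclideanSpace ℝ (Fin n) → ℝ} {Kf Kg : ℝ≥0}
    (hf : LipschitzWith Kf f) (hc : HasCompactSupport f) (hg : LipschitzWith Kg g) :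
    ∃ K, LipschitzWith K fun x => f x * g x := by
  obtain ⟨M, hM⟩ := hc.isCompact.exists_bound_of_continuousOn hg.continuous.continuousOn
  obtain ⟨N, hN⟩ := hc.exists_bound_of_continuous hf.continuous
  have key : ∀ x ∈ tsupport f, ∀ y, dist (f x * g x) (f y * g y) ≤
      (Kf * M.toNNReal + N.toNNReal * Kg : ℝ≥0) * dist x y := by
    intro x hx y
    have h1 : f x * g x - f y * g y = (f x - f y) * g x + f y * (g x - g y) := by ring
    rw [Real.dist_eq, h1]
    refine (abs_add_le _ _).trans ?_
    rw [abs_mul, abs_mul, ← Real.dist_eq, ← Real.dist_eq]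
    push_cast
    have h2 : |g x| ≤ (M.toNNReal : ℝ) := (hM x hx).trans (Real.le_coe_toNNReal M)
    have h3 : |f y| ≤ (N.toNNReal : ℝ) := (hN y).trans (Real.le_coe_toNNReal N)
    calc dist (f x) (f y) * |g x| + |f y| * dist (g x) (g y)
        ≤ (Kf * dist x y) * M.toNNReal + N.toNNReal * (Kg * dist x y) := by
          gcongr
          · exact hf.dist_le_mul x y
          · exact hg.dist_le_mul x y
      _ = _ := by ring
  refine ⟨Kf * M.toNNReal + N.toNNReal * Kg, LipschitzWith.of_dist_le_mul fun x y => ?_⟩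
  by_cases hx : x ∈ tsupport f
  · exact key x hx y
  by_cases hy : y ∈ tsupport f
  · rw [dist_comm, dist_comm x]
    exact key y hy x
  · simp only [image_eq_zero_of_notMem_tsupport hx, image_eq_zero_of_notMem_tsupport hy, zero_mul,
      dist_self]
    positivity

lemma exists_lipschitz_cutoff {s : Set (EuclideanSpace ℝ (Fin n))} (hs : IsCompact s) :
    ∃ χ : EuclideanSpace ℝ (Fin n) → ℝ, LipschitzWith 1 χ ∧ HasCompactSupport χ ∧
      ∀ x ∈ s, χ =ᶠ[𝓝 x] fun _ => 1 := by
  obtain ⟨R, hR⟩ := hs.isBounded.subset_closedBall 0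
  refine ⟨fun x => max 0 (min 1 (R + 2 - ‖x‖)), ?_, ?_, ?_⟩
  · refine LipschitzWith.const_max (LipschitzWith.const_min ?_ 1) 0
    refine LipschitzWith.of_dist_le_mul fun x y => ?_
    rw [Real.dist_eq, show R + 2 - ‖x‖ - (R + 2 - ‖y‖) = ‖y‖ - ‖x‖ by ring, NNReal.coe_one, one_mul,
      dist_comm, dist_eq_norm]
    exact abs_norm_sub_norm_le y x
  · refine HasCompactSupport.intro (isCompact_closedBall 0 (R + 2)) fun x hx => ?_
    rw [mem_closedBall_zero_iff, not_le] at hx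
    exact max_eq_left (min_le_of_right_le (by linarith))
  · intro x hx
    have hx : ‖x‖ < R + 1 := by
      have := mem_closedBall_zero_iff.mp (hR hx)
      linarith
    filter_upwards [continuous_norm.continuousAt.eventually_lt continuousAt_const hx] with y hy
    rw [min_eq_left (by linarith), max_eq_right zero_le_one]

/-- The Jacobian determinant of a Lipschitz map has zero integral as soon as one component is
compactly supported. -/
theorem integral_jac_eq_zero {f : Fin n → EuclideanSpace ℝ (Fin n) → ℝ}
    (hf : ∀ i, ∃ K, LipschitzWith K (f i)) (i : Fin n) (hc : HasCompactSupport (f i)) :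
    ∫ x, jac f x = 0 := by
  obtain ⟨χ, hχ, hχc, hχ1⟩ := exists_lipschitz_cutoff hc.isCompact
  have hlip : ∀ j, ∃ K, LipschitzWith K fun x => χ x * f j x := fun j =>
    exists_lipschitzWith_mul hχ hχc (hf j).choose_spec
  choose K hK using hlip
  have hsup : ∀ j, LipschitzWith (∑ j, K j) fun x => χ x * f j x := fun j =>
    (hK j).weaken (Finset.single_le_sum (fun _ _ => zero_le) (Finset.mem_univ j))
  rw [← integral_jac_eq_zero_of_forall_hasCompactSupport i.pos hsup fun j => hχc.mul_right]
  congr 1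
  ext x
  -- Near the support of `f i` the cutoff is `1`; off it, row `i` vanishes in both determinants.
  by_cases hx : x ∈ tsupport (f i)
  · refine jac_congr_of_eventuallyEq fun j => ?_
    filter_upwards [hχ1 x hx] with y hy
    rw [hy, one_mul]
  · rw [jac_eq_zero_of_notMem_tsupport i hx, jac_eq_zero_of_notMem_tsupport i]
    exact fun h => hx (tsupport_mul_subset_right h)

lemma integrable_mul_jac {f : Fin n → EuclideanSpace ℝ (Fin n) → ℝ}
    {K : ℝ≥0} (hf : ∀ i, LipschitzWith K (f i)) {ψ : EuclideanSpace ℝ (Fin n) → ℝ}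
    (hψ : Integrable ψ) : Integrable fun x => ψ x * jac f x := by
  simp_rw [mul_comm (ψ _)]
  exact hψ.bdd_mul (measurable_jac f).aestronglyMeasurable (ae_of_all _ fun x => abs_jac_le hf x)

lemma jac_update_mul {f : Fin n → EuclideanSpace ℝ (Fin n) → ℝ} (i : Fin n)
    {ψ w : EuclideanSpace ℝ (Fin n) → ℝ} {x : EuclideanSpace ℝ (Fin n)}
    (hψ : DifferentiableAt ℝ ψ x) (hw : DifferentiableAt ℝ w x) :
    jac (Function.update f i fun y => ψ y * w y) x =
      ψ x * jac (Function.update f i w) x + w x * jac (Function.update f i ψ) x := by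
  simp only [jac, partials_update, partials_mul hψ hw]
  rw [MultilinearMap.map_update_add, MultilinearMap.map_update_smul,
    MultilinearMap.map_update_smul, smul_eq_mul, smul_eq_mul]

/-- Integration by parts for Jacobian determinants. -/
theorem integral_mul_jac_update {f : Fin n → EuclideanSpace ℝ (Fin n) → ℝ} {K : ℝ≥0}
    (hf : ∀ i, LipschitzWith K (f i)) (i : Fin n) {ψ w : EuclideanSpace ℝ (Fin n) → ℝ}
    (hψ : LipschitzWith K ψ) (hψc : HasCompactSupport ψ) (hw : LipschitzWith K w) :
    ∫ x, ψ x * jac (Function.update f i w) x =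
      -∫ x in tsupport ψ, w x * jac (Function.update f i ψ) x := by
  have hupd : ∀ {v : EuclideanSpace ℝ (Fin n) → ℝ}, LipschitzWith K v →
      ∀ j, LipschitzWith K (Function.update f i v j) := fun {v} hv j => by
    by_cases hj : j = i
    · subst hj; simpa using hv
    · simpa [hj] using hf j
  have hz : ∀ x ∉ tsupport ψ, w x * jac (Function.update f i ψ) x = 0 := fun x hx => by
    rw [jac_eq_zero_of_notMem_tsupport i (by simpa using hx), mul_zero]
  -- The product `ψ w` in slot `i` has compact support; the Leibniz rule in that row splits this
  -- zero into the two desired terms.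
  have h0 : ∫ x, jac (Function.update f i fun y => ψ y * w y) x = 0 := by
    refine integral_jac_eq_zero (fun j => ?_) i ?_
    · by_cases hj : j = i
      · subst hj; simpa using exists_lipschitzWith_mul hψ hψc hw
      · exact ⟨K, by simpa [hj] using hf j⟩
    · rw [Function.update_self]
      exact hψc.mul_right
  rw [setIntegral_eq_integral_of_forall_compl_eq_zero hz, eq_neg_iff_add_eq_zero,
    ← integral_add]
  · rw [← h0]
    refine integral_congr_ae ?_
    filter_upwards [hψ.ae_differentiableAt, hw.ae_differentiableAt] with x h1 h2
    exact (jac_update_mul i h1 h2).symm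
  · exact integrable_mul_jac (hupd hw)
      (hψ.continuous.integrable_of_hasCompactSupport hψc)
  · refine IntegrableOn.integrable_of_forall_notMem_eq_zero (s := tsupport ψ) ?_ hz
    obtain ⟨M, hM⟩ := hψc.isCompact.exists_bound_of_continuousOn hw.continuous.continuousOn
    refine Integrable.bdd_mul (c := M)
      (integrableOn_jac (hupd hψ) hψc.isCompact.measure_lt_top.ne)
      hw.continuous.aestronglyMeasurable ?_
    filter_upwards [ae_restrict_mem hψc.isCompact.measurableSet] with x hx using hM x hx

/-- Weak continuity of Jacobian determinants, tested with Lipschitz functions. -/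
lemma tendsto_integral_mul_jac_of_lipschitzWith
    {φ : ℕ → Fin n → EuclideanSpace ℝ (Fin n) → ℝ} {u : Fin n → EuclideanSpace ℝ (Fin n) → ℝ}
    {K K' : ℝ≥0} (hφ : ∀ k i, LipschitzWith K (φ k i)) (hu : ∀ i, LipschitzWith K (u i))
    (hlim : ∀ i, TendstoUniformly (fun k => φ k i) (u i) atTop)
    {ψ : EuclideanSpace ℝ (Fin n) → ℝ} (hψ : LipschitzWith K' ψ) (hψc : HasCompactSupport ψ) :
    Tendsto (fun k => ∫ x, ψ x * jac (φ k) x) atTop (𝓝 (∫ x, ψ x * jac u x)) := by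
  set M : ℝ≥0 := K + K + K' with hM
  have hKM : K ≤ M := by rw [hM, add_assoc]; exact le_self_add
  have hψM : LipschitzWith M ψ := hψ.weaken le_add_self
  have hψi : Integrable ψ := hψ.continuous.integrable_of_hasCompactSupport hψc
  have hpw : ∀ k (S : Finset (Fin n)) i, LipschitzWith K (S.piecewise (φ k) u i) := fun k S i => by
    by_cases hi : i ∈ S
    · simpa [hi] using hφ k i
    · simpa [hi] using hu i
  -- Components of `u` are replaced by those of `φ k` one at a time.
  suffices H : ∀ S : Finset (Fin n),
      Tendsto (fun k => ∫ x, ψ x * jac (S.piecewise (φ k) u) x) atTop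
        (𝓝 (∫ x, ψ x * jac u x)) by
    simpa using H Finset.univ
  intro S
  induction S using Finset.induction_on with
  | empty => simp
  | insert i S hi ih =>
    have hw : ∀ k, LipschitzWith (K + K) fun x => φ k i x - u i x := fun k => (hφ k i).sub (hu i)
    have hupd : ∀ k (v : EuclideanSpace ℝ (Fin n) → ℝ), LipschitzWith M v →
        ∀ j, LipschitzWith M (Function.update (S.piecewise (φ k) u) i v j) := fun k v hv j => by
      by_cases hj : j = i
      · subst hj; simpa using hv
      · simpa [hj] using (hpw k S j).weaken hKM
    have hsplit : ∀ k, ∫ x, ψ x * jac ((insert i S).piecewise (φ k) u) x =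
        (∫ x, ψ x * jac (S.piecewise (φ k) u) x) -
          ∫ x in tsupport ψ, (φ k i x - u i x) *
            jac (Function.update (S.piecewise (φ k) u) i ψ) x := by
      intro k
      rw [sub_eq_add_neg, ← integral_mul_jac_update (fun j => (hpw k S j).weaken hKM) i hψM hψc
        ((hw k).weaken le_self_add), ← integral_add (integrable_mul_jac (hpw k S) hψi)
        (integrable_mul_jac (hupd k _ ((hw k).weaken le_self_add)) hψi)]
      refine integral_congr_ae ?_
      filter_upwards [(hφ k i).ae_differentiableAt, (hu i).ae_differentiableAt] with x h1 h2
      rw [← mul_add]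
      congr 1
      -- As `i ∉ S`, slot `i` still holds `u i`, so additivity in that row isolates `φ k i - u i`.
      have h3 : S.piecewise (φ k) u = Function.update (S.piecewise (φ k) u) i (u i) := by
        rw [Function.eq_update_iff]
        simp [hi]
      have h4 : partials (φ k i) x =
          partials (u i) x + partials (fun y => φ k i y - u i y) x := by
        ext j
        simp [partials, fderiv_fun_sub h1 h2]
      rw [Finset.piecewise_insert]
      conv_rhs => enter [1]; rw [h3]
      simp only [jac, partials_update]
      rw [← MultilinearMap.map_update_add, ← h4]
    simp_rw [hsplit]
    -- After integration by parts the difference is undifferentiated, so uniform convergence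
    -- suffices.
    have hzero : Tendsto (fun k => ∫ x in tsupport ψ, (φ k i x - u i x) *
        jac (Function.update (S.piecewise (φ k) u) i ψ) x) atTop (𝓝 0) := by
      set C : ℝ := n.factorial * (M : ℝ) ^ n with hC
      have hC0 : 0 ≤ C := by positivity
      rw [Metric.tendsto_atTop]
      intro ε hε
      set V := volume.real (tsupport ψ)
      have hV : 0 ≤ V := measureReal_nonneg
      have hδ : 0 < ε / (C * V + 1) := by positivity
      obtain ⟨N, hN⟩ := eventually_atTop.mp
        (Metric.tendstoUniformly_iff.mp (hlim i) _ hδ)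
      refine ⟨N, fun k hk => ?_⟩
      rw [dist_zero_right]
      have hb := norm_setIntegral_le_of_norm_le_const (μ := volume)
        (f := fun x => (φ k i x - u i x) * jac (Function.update (S.piecewise (φ k) u) i ψ) x)
        (C := ε / (C * V + 1) * C) hψc.isCompact.measure_lt_top fun x _ => by
          rw [norm_mul]
          gcongr
          · rw [← dist_eq_norm, dist_comm]
            exact (hN k hk x).le
          · exact abs_jac_le (hupd k ψ hψM) x
      refine hb.trans_lt ?_
      rw [mul_assoc, div_mul_eq_mul_div, div_lt_iff₀ (by positivity)]
      linarith
    simpa using ih.sub hzero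

/-- Weak-* continuity of Jacobian determinants. -/
theorem tendsto_integral_mul_jac
    {φ : ℕ → Fin n → EuclideanSpace ℝ (Fin n) → ℝ} {u : Fin n → EuclideanSpace ℝ (Fin n) → ℝ}
    {K : ℝ≥0} (hφ : ∀ k i, LipschitzWith K (φ k i)) (hu : ∀ i, LipschitzWith K (u i))
    (hlim : ∀ i, TendstoUniformly (fun k => φ k i) (u i) atTop)
    {ψ : EuclideanSpace ℝ (Fin n) → ℝ} (hψ : Integrable ψ) :
    Tendsto (fun k => ∫ x, ψ x * jac (φ k) x) atTop (𝓝 (∫ x, ψ x * jac u x)) := by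
  set C : ℝ := n.factorial * (K : ℝ) ^ n with hC
  have hC0 : 0 ≤ C := by positivity
  rw [Metric.tendsto_atTop]
  intro ε hε
  -- The Jacobians are uniformly bounded by `C`, so an `L¹` approximation of `ψ` costs at most `ε /
  -- 4` for each of them.
  obtain ⟨g, hgc, hgs, hg⟩ := (memLp_one_iff_integrable.mpr hψ).exist_eLpNorm_sub_le
    ENNReal.one_ne_top le_rfl (ε := ε / (4 * (C + 1))) (by positivity)
  obtain ⟨Kg, hgl⟩ := hgs.lipschitzWith_of_hasCompactSupport hgc (by simp)
  have hgi : Integrable g := hgs.continuous.integrable_of_hasCompactSupport hgc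
  have hsub : Integrable fun x => ψ x - g x := hψ.sub hgi
  have hdiff : ∫ x, ‖ψ x - g x‖ ≤ ε / (4 * (C + 1)) := by
    rw [integral_norm_eq_lintegral_enorm hsub.aestronglyMeasurable]
    rw [eLpNorm_one_eq_lintegral_enorm] at hg
    exact ENNReal.toReal_le_of_le_ofReal (by positivity) hg
  have herr : ∀ f : Fin n → EuclideanSpace ℝ (Fin n) → ℝ, (∀ i, LipschitzWith K (f i)) →
      |(∫ x, ψ x * jac f x) - ∫ x, g x * jac f x| ≤ ε / 4 := by
    intro f hf
    rw [← integral_sub (integrable_mul_jac hf hψ) (integrable_mul_jac hf hgi)]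
    calc |∫ x, (ψ x * jac f x - g x * jac f x)| ≤ ∫ x, ‖ψ x - g x‖ * C := by
          refine norm_integral_le_of_norm_le (f := fun x => ψ x * jac f x - g x * jac f x)
            (hsub.norm.mul_const C) (ae_of_all _ fun x => ?_)
          rw [← sub_mul, norm_mul]
          gcongr
          exact abs_jac_le hf x
      _ = (∫ x, ‖ψ x - g x‖) * C := integral_mul_const _ _
      _ ≤ ε / (4 * (C + 1)) * C := by gcongr
      _ ≤ ε / 4 := by
          rw [div_mul_eq_mul_div, div_le_div_iff₀ (by positivity) (by positivity)]
          nlinarith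
  obtain ⟨N, hN⟩ := Metric.tendsto_atTop.mp
    (tendsto_integral_mul_jac_of_lipschitzWith hφ hu hlim hgl hgc) (ε / 4) (by positivity)
  refine ⟨N, fun k hk => ?_⟩
  have h1 := hN k hk
  have h2 := herr _ (hφ k)
  have h3 := herr _ hu
  rw [Real.dist_eq] at h1 ⊢
  rw [abs_lt] at h1 ⊢
  rw [abs_le] at h2 h3
  constructor <;> linarith

/-! ### Extended integrals, subgradients and Lipschitz extensions -/

section ExtIntegral

variable {α : Type*} [MeasurableSpace α] {μ : Measure α}

lemma extIntegral_mono {f g : α → ℝ} (hfg : f ≤ᵐ[μ] g) : extIntegral μ f ≤ extIntegral μ g := by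
  refine EReal.sub_le_sub ?_ ?_
  · refine EReal.coe_ennreal_le_coe_ennreal_iff.mpr (lintegral_mono_ae ?_)
    filter_upwards [hfg] with x hx using ENNReal.ofReal_le_ofReal hx
  · refine EReal.coe_ennreal_le_coe_ennreal_iff.mpr (lintegral_mono_ae ?_)
    filter_upwards [hfg] with x hx using ENNReal.ofReal_le_ofReal (neg_le_neg hx)

lemma extIntegral_eq_integral {f : α → ℝ} (hf : Integrable f μ) :
    extIntegral μ f = ((∫ x, f x ∂μ : ℝ) : EReal) := by
  rw [integral_eq_lintegral_pos_part_sub_lintegral_neg_part hf, EReal.coe_sub, extIntegral]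
  have h1 : ∫⁻ x, ENNReal.ofReal (f x) ∂μ ≠ ⊤ := hf.lintegral_lt_top.ne
  have h2 : ∫⁻ x, ENNReal.ofReal (-f x) ∂μ ≠ ⊤ := hf.neg.lintegral_lt_top.ne
  rw [← EReal.toReal_coe_ennreal, ← EReal.toReal_coe_ennreal, EReal.coe_toReal (by simpa using h1)
    (EReal.coe_ennreal_ne_bot _), EReal.coe_toReal (by simpa using h2) (EReal.coe_ennreal_ne_bot _)]

end ExtIntegral

lemma add_rightDeriv_mul_le {G : ℝ → ℝ} (hG : ConvexOn ℝ (Set.Ioi 0) G) {s t : ℝ}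
    (ht : 0 < t) (hs : 0 < s) : G t + derivWithin G (Set.Ioi t) t * (s - t) ≤ G s := by
  have hti : t ∈ interior (Set.Ioi (0 : ℝ)) := by simpa using ht
  rcases lt_trichotomy s t with hst | rfl | hst
  · have h1 := hG.slope_le_leftDeriv_of_mem_interior hs hti hst
    have h2 := hG.leftDeriv_le_rightDeriv_of_mem_interior hti
    have h3 := h1.trans h2
    rw [slope_def_field, div_le_iff₀ (by linarith)] at h3
    linarith
  · simp
  · have h3 := hG.rightDeriv_le_slope_of_mem_interior hti hs hst
    rw [slope_def_field, le_div_iff₀ (by linarith)] at h3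
    linarith

/-- Separate extensions of `φ k` and `u` need not converge uniformly off `Ω`. Instead `φ k - u` is
extended and truncated at its bound on `Ω`. -/
lemma exists_lipschitz_extension {Ω : Set (EuclideanSpace ℝ (Fin n))}
    {φ : ℕ → EuclideanSpace ℝ (Fin n) → EuclideanSpace ℝ (Fin n)} {K : ℝ≥0}
    (hφ : ∀ k, LipschitzOnWith K (φ k) Ω)
    {u : EuclideanSpace ℝ (Fin n) → EuclideanSpace ℝ (Fin n)} {Ku : ℝ≥0}
    (hu : LipschitzOnWith Ku u Ω) (hφu : TendstoUniformlyOn φ u atTop Ω) :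
    ∃ (L : ℝ≥0) (Φ : ℕ → Fin n → EuclideanSpace ℝ (Fin n) → ℝ)
      (U : Fin n → EuclideanSpace ℝ (Fin n) → ℝ),
      (∀ k i, LipschitzWith L (Φ k i)) ∧ (∀ i, LipschitzWith L (U i)) ∧
      (∀ i, TendstoUniformly (fun k => Φ k i) (U i) atTop) ∧
      (∀ k i, Set.EqOn (Φ k i) (fun x => φ k x i) Ω) ∧ ∀ i, Set.EqOn (U i) (fun x => u x i) Ω := by
  have hcoord : ∀ i, LipschitzWith 1 fun y : EuclideanSpace ℝ (Fin n) => y i := fun i =>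
    LipschitzWith.of_dist_le_mul fun x y => by
      simpa [dist_eq_norm] using PiLp.norm_apply_le (x - y) i
  have hU : ∀ i, ∃ U : EuclideanSpace ℝ (Fin n) → ℝ, LipschitzWith (1 * Ku) U ∧
      Set.EqOn (fun x => u x i) U Ω := fun i => ((hcoord i).comp_lipschitzOnWith hu).extend_real
  choose U hUl hUe using hU
  have hW : ∀ k i, ∃ W : EuclideanSpace ℝ (Fin n) → ℝ, LipschitzWith (K + Ku) W ∧
      Set.EqOn (fun x => φ k x i - u x i) W Ω ∧
      ∀ ε : ℝ, 0 ≤ ε → (∀ x ∈ Ω, |φ k x i - u x i| ≤ ε) → ∀ x, |W x| ≤ ε := by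
    intro k i
    have hl : LipschitzOnWith (K + Ku) (fun x => φ k x i - u x i) Ω := by
      have h1 := (hcoord i).comp_lipschitzOnWith (hφ k)
      have h2 := (hcoord i).comp_lipschitzOnWith hu
      rw [one_mul] at h1 h2
      exact h1.sub h2
    obtain ⟨W, hWl, hWe⟩ := hl.extend_real
    by_cases hb : ∃ ε : ℝ, 0 ≤ ε ∧ ∀ x ∈ Ω, |φ k x i - u x i| ≤ ε
    · set S := {ε : ℝ | 0 ≤ ε ∧ ∀ x ∈ Ω, |φ k x i - u x i| ≤ ε} with hS
      have hne : S.Nonempty := hb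
      have hbd : BddBelow S := ⟨0, fun ε hε => hε.1⟩
      have h0 : 0 ≤ sInf S := le_csInf hne fun ε hε => hε.1
      have hle : ∀ x ∈ Ω, |φ k x i - u x i| ≤ sInf S := fun x hx =>
        le_csInf hne fun ε hε => hε.2 x hx
      refine ⟨fun x => max (-sInf S) (min (sInf S) (W x)), (hWl.const_min _).const_max _, ?_, ?_⟩
      · intro x hx
        have h1 := abs_le.mp (hle x hx)
        simp only
        rw [← hWe hx, min_eq_right h1.2, max_eq_right h1.1]
      · intro ε hε hx x
        have h2 : sInf S ≤ ε := csInf_le hbd ⟨hε, hx⟩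
        refine le_trans (abs_le.mpr ⟨le_max_left _ _, max_le (by linarith) (min_le_left _ _)⟩) h2
    · exact ⟨W, hWl, hWe, fun ε hε hx => absurd ⟨ε, hε, hx⟩ hb⟩
  choose W hWl hWe hWb using hW
  refine ⟨1 * Ku + (K + Ku), fun k i x => U i x + W k i x, U, fun k i => (hUl i).add (hWl k i),
    fun i => (hUl i).weaken le_self_add, fun i => ?_, fun k i x hx => ?_,
    fun i x hx => (hUe i hx).symm⟩
  · rw [Metric.tendstoUniformly_iff]
    intro ε hε
    filter_upwards [Metric.tendstoUniformlyOn_iff.mp hφu (ε / 2) (by positivity)] with k hk x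
    rw [dist_comm, Real.dist_eq, add_sub_cancel_left]
    refine (hWb k i (ε / 2) (by positivity) (fun y hy => ?_) x).trans_lt (by linarith)
    have h1 := (hcoord i).dist_le_mul (φ k y) (u y)
    rw [Real.dist_eq, NNReal.coe_one, one_mul, dist_comm] at h1
    exact h1.trans (hk y hy).le
  · simp only
    rw [← hUe i hx, ← hWe k i hx]
    ring

/-! ### Bounds on the limiting determinant -/

lemma ae_det_fderiv_eq_jac {Ω : Set (EuclideanSpace ℝ (Fin n))} (hΩ : IsOpen Ω)
    {F : EuclideanSpace ℝ (Fin n) → EuclideanSpace ℝ (Fin n)} {K : ℝ≥0}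
    (hF : LipschitzOnWith K F Ω) {f : Fin n → EuclideanSpace ℝ (Fin n) → ℝ}
    (hf : ∀ i, Set.EqOn (f i) (fun x => F x i) Ω) :
    ∀ᵐ x ∂volume.restrict Ω, DifferentiableAt ℝ F x ∧ (fderiv ℝ F x).det = jac f x := by
  filter_upwards [hF.ae_differentiableWithinAt hΩ.measurableSet,
    ae_restrict_mem hΩ.measurableSet] with x hx hxΩ
  have hd := hx.differentiableAt (hΩ.mem_nhds hxΩ)
  refine ⟨hd, ?_⟩
  rw [det_fderiv_eq_jac hd]
  exact jac_congr_of_eventuallyEq fun i =>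
    ((hf i).eventuallyEq_of_mem (hΩ.mem_nhds hxΩ)).symm

lemma norm_le_mul_norm_fderiv {Ω : Set (EuclideanSpace ℝ (Fin n))} (hΩ : IsOpen Ω)
    {u : EuclideanSpace ℝ (Fin n) → EuclideanSpace ℝ (Fin n)} {K : ℝ≥0}
    (hu : ∀ x ∈ Ω, ∀ y ∈ Ω, dist x y ≤ K * dist (u x) (u y)) {x : EuclideanSpace ℝ (Fin n)}
    (hx : x ∈ Ω) (hd : DifferentiableAt ℝ u x) (v : EuclideanSpace ℝ (Fin n)) :
    ‖v‖ ≤ K * ‖fderiv ℝ u x v‖ := by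
  have h0 : HasDerivAt (fun t : ℝ => u (x + t • v)) (fderiv ℝ u x v) 0 :=
    hd.hasFDerivAt.hasLineDerivAt v
  have h1 := h0.tendsto_slope_zero
  simp only [zero_add, zero_smul, add_zero] at h1
  refine ge_of_tendsto (h1.norm.const_mul (K : ℝ)) ?_
  have hmem : ∀ᶠ t in 𝓝 (0 : ℝ), x + t • v ∈ Ω := by
    have hc : Continuous fun t : ℝ => x + t • v := by fun_prop
    refine hc.continuousAt.eventually_mem (hΩ.mem_nhds ?_)
    simpa using hx
  filter_upwards [hmem.filter_mono nhdsWithin_le_nhds, self_mem_nhdsWithin] with t ht ht0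
  have ht0 : t ≠ 0 := ht0
  have h2 := hu _ ht _ hx
  rw [dist_eq_norm, dist_eq_norm, add_sub_cancel_left, norm_smul] at h2
  rw [norm_smul, norm_inv]
  have h3 : 0 < ‖t‖ := norm_pos_iff.mpr ht0
  rw [mul_left_comm, ← div_eq_inv_mul, le_div_iff₀ h3]
  linarith

/-- The inverse of `A` is `K`-Lipschitz, so its determinant obeys the Jacobian bound; the `+ 1`
keeps the denominator positive. -/
lemma inv_le_abs_det {A : EuclideanSpace ℝ (Fin n) →L[ℝ] EuclideanSpace ℝ (Fin n)} {K : ℝ≥0}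
    (hA : ∀ v, ‖v‖ ≤ K * ‖A v‖) : 1 / ((n.factorial : ℝ) * (K : ℝ) ^ n + 1) ≤ |A.det| := by
  have hinj : Function.Injective A.toLinearMap := by
    rw [injective_iff_map_eq_zero]
    intro v hv
    have h1 := hA v
    rw [show A v = 0 from hv, norm_zero, mul_zero] at h1
    exact norm_le_zero_iff.mp h1
  set e := LinearEquiv.ofInjectiveEndo A.toLinearMap hinj with he
  have hAe : ∀ v, A (e.symm v) = v := fun v => e.apply_symm_apply v
  let B := e.symm.toLinearMap.toContinuousLinearMap
  have hB : ∀ v, ‖B v‖ ≤ K * ‖v‖ := fun v => by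
    have := hA (e.symm v)
    rwa [hAe] at this
  have hdetB : |B.det| ≤ n.factorial * (K : ℝ) ^ n := by
    have h1 := det_fderiv_eq_jac (B.differentiableAt (x := 0))
    rw [ContinuousLinearMap.fderiv] at h1
    rw [h1]
    refine abs_jac_le (fun i => LipschitzWith.of_dist_le_mul fun x y => ?_) 0
    rw [dist_eq_norm, dist_eq_norm]
    refine le_trans ?_ (hB (x - y))
    rw [map_sub]
    exact PiLp.norm_apply_le (B x - B y) i
  have hmul : A.det * B.det = 1 := e.det_mul_det_symm
  have habs : |A.det| * |B.det| = 1 := by rw [← abs_mul, hmul, abs_one]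
  rw [div_le_iff₀ (by positivity), ← habs]
  gcongr
  linarith

/-- The weak limit of nonnegative Jacobian determinants is nonnegative. -/
lemma ae_nonneg_jac_of_tendsto {Ω : Set (EuclideanSpace ℝ (Fin n))} (hΩ : MeasurableSet Ω)
    (hΩf : volume Ω ≠ ⊤)
    {φ : ℕ → Fin n → EuclideanSpace ℝ (Fin n) → ℝ} {u : Fin n → EuclideanSpace ℝ (Fin n) → ℝ}
    {K : ℝ≥0} (hφ : ∀ k i, LipschitzWith K (φ k i)) (hu : ∀ i, LipschitzWith K (u i))
    (hlim : ∀ i, TendstoUniformly (fun k => φ k i) (u i) atTop)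
    (hpos : ∀ k, ∀ᵐ x ∂volume.restrict Ω, 0 ≤ jac (φ k) x) :
    ∀ᵐ x ∂volume.restrict Ω, 0 ≤ jac u x := by
  -- The indicator of the bad set serves as the test function.
  set N := Ω ∩ {x | jac u x < 0} with hN
  have hNm : MeasurableSet N := hΩ.inter (measurableSet_lt (measurable_jac u) measurable_const)
  have hNf : volume N ≠ ⊤ := measure_ne_top_of_subset Set.inter_subset_left hΩf
  have hψ : Integrable (N.indicator fun _ => (1 : ℝ)) :=
    (integrable_indicator_iff hNm).mpr (integrableOn_const hNf)
  have ht := tendsto_integral_mul_jac hφ hu hlim hψ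
  have hind : ∀ f : EuclideanSpace ℝ (Fin n) → ℝ,
      ∫ x, N.indicator (fun _ => (1 : ℝ)) x * f x = ∫ x in N, f x := fun f => by
    rw [← integral_indicator hNm]
    congr 1
    ext x
    by_cases hx : x ∈ N <;> simp [hx]
  simp_rw [hind] at ht
  have h0 : 0 ≤ ∫ x in N, jac u x := ge_of_tendsto' ht fun k =>
    integral_nonneg_of_ae (ae_restrict_of_ae_restrict_of_subset Set.inter_subset_left (hpos k))
  have hneg : 0 ≤ᵐ[volume.restrict N] fun x => -jac u x := by
    filter_upwards [ae_restrict_mem hNm] with x hx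
    exact neg_nonneg.mpr (le_of_lt hx.2)
  have h1 : ∫ x in N, -jac u x = 0 := by
    refine le_antisymm ?_ (integral_nonneg_of_ae hneg)
    rw [integral_neg]
    linarith
  have h2 := (integral_eq_zero_iff_of_nonneg_ae hneg (integrableOn_jac hu hNf).neg).mp h1
  rw [Filter.EventuallyEq, ae_restrict_iff' hNm] at h2
  rw [ae_restrict_iff' hΩ]
  filter_upwards [h2] with x hx hxΩ
  by_contra! hlt
  have := hx ⟨hxΩ, hlt⟩
  simp only [Pi.zero_apply] at this
  linarith

/-- A monotone bounded selection of subgradients on a given interval. -/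
lemma exists_monotone_bounded_subgradient {G : ℝ → ℝ} (hG : ConvexOn ℝ (Set.Ioi 0) G) {c C : ℝ}
    (hc : 0 < c) : ∃ (m : ℝ → ℝ) (M : ℝ), Monotone m ∧ (∀ t, |m t| ≤ M) ∧
      ∀ t, c ≤ t → t ≤ C → ∀ s, 0 < s → G t + m t * (s - t) ≤ G s := by
  let d : ℝ → ℝ := fun t => derivWithin G (Set.Ioi t) t
  have hd : ∀ {s t}, 0 < s → s ≤ t → d s ≤ d t := fun {s t} hs hst =>
    hG.monotoneOn_rightDeriv (by simpa using hs) (by simpa using hs.trans_le hst) hst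
  -- Clamping makes the right derivative globally monotone, hence measurable, and bounded, without
  -- changing it on the interval.
  let r : ℝ → ℝ := fun t => max c (min C t)
  have hr : Monotone r := fun s t hst => by dsimp only [r]; gcongr
  have hrc : ∀ t, c ≤ r t := fun t => le_max_left _ _
  have hrC : ∀ t, r t ≤ max c C := fun t => max_le_max le_rfl (min_le_left _ _)
  refine ⟨fun t => d (r t), max |d c| |d (max c C)|, fun s t hst => hd (hc.trans_le (hrc s)) (hr hst),
    fun t => abs_le_max_abs_abs (hd hc (hrc t)) (hd (hc.trans_le (hrc t)) (hrC t)), ?_⟩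
  intro t ht htC s hs
  have hrt : r t = t := by simp only [r]; rw [min_eq_right htC, max_eq_right ht]
  simp only [hrt]
  exact add_rightDeriv_mul_le hG (hc.trans_le ht) hs

end GLLsc

/-! ### Lower semicontinuity -/

theorem proposition6p1 (n : ℕ)
    (g : (Fin n → ℝ) → ℝ)
    (hg_cont : ContinuousOn g {s | ∀ i, 0 < s i})
    (hg_symm : ∀ s : Fin n → ℝ, (∀ i, 0 < s i) → ∀ π : Equiv.Perm (Fin n), g (s ∘ π) = g s)
    (h : (Fin n → ℝ) → ℝ)
    (hh : ∀ x, h x = g (fun i => Real.exp (x i)))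
    (hh_convex : ConvexOn ℝ Set.univ h)
    (p : (Fin n → ℝ) → ℝ)
    (hp : GLLsc.IsAssociated p h)
    (hp_mono : GLLsc.NonincreasingInEachArgumentOn p (Set.range GLLsc.decreasingPartialSums))
    (Ω : Set (EuclideanSpace ℝ (Fin n)))
    (hΩ_open : IsOpen Ω) (hΩ_bdd : Bornology.IsBounded Ω)
    (φ : ℕ → EuclideanSpace ℝ (Fin n) → EuclideanSpace ℝ (Fin n))
    (hφ_lip : ∃ K : ℝ≥0, ∀ k, LipschitzOnWith K (φ k) Ω)
    (hφ_det : ∀ k, ∀ᵐ x ∂(volume.restrict Ω), fderiv ℝ (φ k) x ∈ GLLsc.glPos n)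
    (u : EuclideanSpace ℝ (Fin n) → EuclideanSpace ℝ (Fin n))
    (hu : GLLsc.IsBiLipschitzOn u Ω)
    (hφu : TendstoUniformlyOn φ u atTop Ω) :
    -- `Du ∈ GL(n, ℝ)⁺` a.e. in `Ω`, and both sides of the inequality are well defined
    (∀ᵐ x ∂(volume.restrict Ω), fderiv ℝ u x ∈ GLLsc.glPos n) ∧
    IntegrableOn (fun x => GLLsc.isotropicPotential g (fderiv ℝ u x)) Ω volume ∧
    (∀ k, AEMeasurable (fun x => GLLsc.isotropicPotential g (fderiv ℝ (φ k) x))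
        (volume.restrict Ω) ∧
      ∫⁻ x, ENNReal.ofReal (-GLLsc.isotropicPotential g (fderiv ℝ (φ k) x))
        ∂(volume.restrict Ω) < ⊤) ∧
    -- the lower semicontinuity inequality
    GLLsc.extIntegral (volume.restrict Ω)
        (fun x => GLLsc.isotropicPotential g (fderiv ℝ u x)) ≤
      liminf (fun k => GLLsc.extIntegral (volume.restrict Ω)
        (fun x => GLLsc.isotropicPotential g (fderiv ℝ (φ k) x))) atTop := by
  have hΩm : MeasurableSet Ω := hΩ_open.measurableSet
  have hΩf : volume Ω ≠ ⊤ := hΩ_bdd.measure_lt_top.ne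
  have : IsFiniteMeasure (volume.restrict Ω) := isFiniteMeasure_restrict.mpr hΩf
  have hh_cont : Continuous h := by
    have : h = g ∘ fun x i => Real.exp (x i) := funext hh
    rw [this]
    exact hg_cont.comp_continuous (by fun_prop) fun x i => Real.exp_pos _
  have hh_symm : ∀ (x : Fin n → ℝ) (π : Equiv.Perm (Fin n)), h (x ∘ π) = h x := fun x π => by
    rw [hh, hh, ← hg_symm _ (fun i => Real.exp_pos (x i)) π]
    rfl
  have hle : ∀ {x c : Fin n → ℝ}, ∑ i, c i ≤ ∑ i, x i → h x ≤ h c :=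
    GLLsc.le_of_sum_le hp hp_mono hh_convex hh_cont hh_symm
  set G : ℝ → ℝ := fun t => GLLsc.sumProfile h (Real.log t) with hG
  have hanti : Antitone (GLLsc.sumProfile h) := GLLsc.antitone_sumProfile hle
  have hGconv : ConvexOn ℝ (Set.Ioi 0) G :=
    GLLsc.convexOn_comp_log (GLLsc.convexOn_sumProfile hh_convex) hanti
  have hGmeas : Measurable G := hanti.measurable.comp Real.measurable_log
  have hGanti : ∀ {s t : ℝ}, 0 < s → s ≤ t → G t ≤ G s := fun hs hst =>
    hanti (Real.log_le_log hs hst)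
  have hw : ∀ F ∈ GLLsc.glPos n, GLLsc.isotropicPotential g F = G F.det := fun F hF =>
    GLLsc.isotropicPotential_eq hh hle hF
  obtain ⟨K, hφK⟩ := hφ_lip
  obtain ⟨⟨Ku, huK⟩, Kb, hub⟩ := hu
  obtain ⟨L, Φ, U, hΦ, hU, hΦU, hΦe, hUe⟩ := GLLsc.exists_lipschitz_extension hφK huK hφu
  have hφJ : ∀ k, ∀ᵐ x ∂volume.restrict Ω, 0 < GLLsc.jac (Φ k) x ∧
      GLLsc.isotropicPotential g (fderiv ℝ (φ k) x) = G (GLLsc.jac (Φ k) x) := by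
    intro k
    filter_upwards [hφ_det k, GLLsc.ae_det_fderiv_eq_jac hΩ_open (hφK k) (hΦe k)] with x h1 h2
    rw [hw _ h1, h2.2, ← h2.2]
    exact ⟨h1, rfl⟩
  have hUnonneg := GLLsc.ae_nonneg_jac_of_tendsto hΩm hΩf hΦ hU hΦU fun k =>
    (hφJ k).mono fun x hx => hx.1.le
  set c : ℝ := 1 / ((n.factorial : ℝ) * (Kb : ℝ) ^ n + 1) with hc
  have hc0 : 0 < c := by positivity
  set C : ℝ := n.factorial * (L : ℝ) ^ n with hC
  have hUJ : ∀ᵐ x ∂volume.restrict Ω, c ≤ GLLsc.jac U x ∧ GLLsc.jac U x ≤ C ∧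
      (fderiv ℝ u x).det = GLLsc.jac U x := by
    filter_upwards [GLLsc.ae_det_fderiv_eq_jac hΩ_open huK hUe, hUnonneg,
      ae_restrict_mem hΩm] with x h1 h2 hx
    have h3 := GLLsc.inv_le_abs_det (GLLsc.norm_le_mul_norm_fderiv hΩ_open hub hx h1.1)
    rw [h1.2, abs_of_nonneg h2] at h3
    exact ⟨h3, (le_abs_self _).trans (GLLsc.abs_jac_le hU x), h1.2⟩
  have hUpos : ∀ᵐ x ∂volume.restrict Ω, fderiv ℝ u x ∈ GLLsc.glPos n := by
    filter_upwards [hUJ] with x hx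
    exact hc0.trans_le (hx.2.2 ▸ hx.1)
  have hwU : (fun x => GLLsc.isotropicPotential g (fderiv ℝ u x)) =ᵐ[volume.restrict Ω]
      fun x => G (GLLsc.jac U x) := by
    filter_upwards [hUJ, hUpos] with x h1 h2
    rw [hw _ h2, h1.2.2]
  have hGU : Integrable (fun x => G (GLLsc.jac U x)) (volume.restrict Ω) := by
    refine Integrable.of_bound (C := max |G C| |G c|)
      (hGmeas.comp (GLLsc.measurable_jac U)).aestronglyMeasurable ?_
    filter_upwards [hUJ] with x hx
    exact abs_le_max_abs_abs (hGanti (hc0.trans_le hx.1) hx.2.1) (hGanti hc0 hx.1)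
  obtain ⟨m, M, hm, hmM, hsub⟩ := GLLsc.exists_monotone_bounded_subgradient hGconv (C := C) hc0
  set q : EuclideanSpace ℝ (Fin n) → ℝ := fun x => m (GLLsc.jac U x) with hq
  have hqm : Measurable q := hm.measurable.comp (GLLsc.measurable_jac U)
  have hqi : Integrable q (volume.restrict Ω) :=
    Integrable.of_bound hqm.aestronglyMeasurable M (ae_of_all _ fun x => hmM _)
  have hqJ : ∀ f : Fin n → EuclideanSpace ℝ (Fin n) → ℝ, (∀ i, LipschitzWith L (f i)) →
      Integrable (fun x => q x * GLLsc.jac f x) (volume.restrict Ω) := fun f hf =>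
    (GLLsc.integrableOn_jac hf hΩf).bdd_mul hqm.aestronglyMeasurable (ae_of_all _ fun x => hmM _)
  -- This integrable minorant of `w(Dφₖ)`, affine in the Jacobian of `Φ k`, gives both the
  -- integrable negative part and, by weak convergence, the limit inequality.
  let r : ℕ → EuclideanSpace ℝ (Fin n) → ℝ := fun k x =>
    G (GLLsc.jac U x) + (q x * GLLsc.jac (Φ k) x - q x * GLLsc.jac U x)
  have hri : ∀ k, Integrable (r k) (volume.restrict Ω) := fun k =>
    hGU.add ((hqJ _ (hΦ k)).sub (hqJ _ hU))
  have hrle : ∀ k, r k ≤ᵐ[volume.restrict Ω]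
      fun x => GLLsc.isotropicPotential g (fderiv ℝ (φ k) x) := by
    intro k
    filter_upwards [hφJ k, hUJ] with x h1 h2
    have h3 := hsub _ h2.1 h2.2.1 _ h1.1
    rw [mul_sub] at h3
    rw [h1.2]
    exact h3
  have hrlim : Tendsto (fun k => ∫ x in Ω, r k x) atTop (𝓝 (∫ x in Ω, G (GLLsc.jac U x))) := by
    have h1 := GLLsc.tendsto_integral_mul_jac hΦ hU hΦU ((integrable_indicator_iff hΩm).mpr hqi)
    have hind : ∀ f : EuclideanSpace ℝ (Fin n) → ℝ,
        ∫ x, Ω.indicator q x * f x = ∫ x in Ω, q x * f x := fun f => by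
      rw [← integral_indicator hΩm]
      congr 1
      ext x
      by_cases hx : x ∈ Ω <;> simp [hx]
    simp_rw [hind] at h1
    have h2 : ∀ k, ∫ x in Ω, r k x = (∫ x in Ω, G (GLLsc.jac U x)) +
        ((∫ x in Ω, q x * GLLsc.jac (Φ k) x) - ∫ x in Ω, q x * GLLsc.jac U x) := fun k => by
      rw [← integral_sub (hqJ _ (hΦ k)) (hqJ _ hU)]
      exact integral_add hGU ((hqJ _ (hΦ k)).sub (hqJ _ hU))
    simp_rw [h2]
    simpa using (h1.sub_const (∫ x in Ω, q x * GLLsc.jac U x)).const_add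
      (∫ x in Ω, G (GLLsc.jac U x))
  refine ⟨hUpos, hGU.congr hwU.symm, fun k => ⟨?_, ?_⟩, ?_⟩
  · exact ⟨_, hGmeas.comp (GLLsc.measurable_jac (Φ k)), (hφJ k).mono fun x hx => hx.2⟩
  · refine lt_of_le_of_lt (lintegral_mono_ae ?_) (hri k).neg.lintegral_lt_top
    filter_upwards [hrle k] with x hx using ENNReal.ofReal_le_ofReal (neg_le_neg hx)
  · rw [GLLsc.extIntegral_eq_integral (hGU.congr hwU.symm), integral_congr_ae hwU,
      ← ((continuous_coe_real_ereal.tendsto _).comp hrlim).liminf_eq]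
    refine liminf_le_liminf (Eventually.of_forall fun k => ?_)
    rw [Function.comp_apply, ← GLLsc.extIntegral_eq_integral (hri k)]
    exact GLLsc.extIntegral_mono (hrle k)
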